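/- Let $p\ge 1$ and let $D=(d_{ij})$ be the $2^{p-1}\times p$ design matrix, $d_{ij}\in\{-1,1\}$, of a regular $2^{p-1}$ fractional factorial design of resolution $p$ for $p$ two-level factors: the rows of $D$ are distinct and are exactly the solutions $x\in\{-1,1\}^p$ of a system of defining relations $\prod_{j\in w}x_j=\pm1$, and $p$ is the smallest size of a nonempty $w\subseteq\{1,\dots,p\}$ for which $\prod_{j\in w}d_{ij}$ does not depend on $i$. Put $k=2^{p-1}$ and let $M=(\mathbf 1\mid D)$ be the $k\times(p+1)$ model matrix of the main effect model, with transpose $M'$. The fiber of $y\in\mathbb N^k$ is $\mathcal F(M'y)=\{x\in\mathbb N^k: M'x=M'y\}$, and a move is a $z\in\mathbb Z^k$ with $M'z=0$. A finite set $\mathcal B$ of moves connects a fiber if the graph on the fiber, in which distinct $x,y$ are adjacent iff $y=x\pm z$ for some $z\in\mathcal B$, is connected. A Markov basis is a finite set of moves that connects every fiber; it is minimal if no proper subset is a Markov basis. An essential fiber is a fiber $\mathcal F(M'y)$ with $\sum_i y_i=2$ that has more than one element. Let $p=2s$ or $p=2s+1$. 1. Every essential fiber has exactly $4^{s-t}$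 elements for some $t\in\{1,\dots,s-1\}$. For each $t\in\{1,\dots,s-1\}$, the number $N_t$ of essential fibers with exactly $4^{s-t}$ elements is $$N_t=4^{t-1}\binom{p}{2(t-1)}\ \text{ if } p=2s,\qquad N_t=2^{2t-1}\binom{p}{2t-1}\ \text{ if } p=2s+1.$$ 2. Minimal Markov bases exist, and a finite set $\mathcal B\subset\mathbb Z^k$ is a minimal Markov basis for $M'$ if and only if $$\mathcal B=\bigcup_{t=1}^{s-1}\ \bigcup_{F}\ \mathcal C_F,$$ where $F$ runs over the $N_t$ essential fibers with $4^{s-t}$ elements and each $\mathcal C_F$ is an inclusion-minimal set, among the finite sets of differences of elements of $F$, that connects $F$. Every such $\mathcal C_F$ has exactly $4^{s-t}-1$ elements. 3. Hence every minimal Markov basis has exactly $\sum_{t=1}^{s-1}N_t\,(4^{s-t}-1)$ elements; for $p=4,5,6,7,8$ these sizes are $3,30,195,1050,5103$. -/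

import Mathlib

open Matrix

namespace FactorialDesign

/-- A two-level design with `k` runs and `p` factors is given by its design matrix
`D : Fin k → Fin p → ℤˣ` (recall `ℤˣ = {1, -1}`). It is a regular fraction if its runs are
pairwise distinct and form exactly the solution set of a collection of defining relations
`∏ j ∈ w, x j = e`, with `w` a set of factors and `e` a sign. -/
def IsRegularFraction {k p : ℕ} (D : Fin k → Fin p → ℤˣ) : Prop :=
  Function.Injective D ∧
    ∃ W : Set (Finset (Fin p) × ℤˣ),
      Set.range D = {x | ∀ r ∈ W, ∏ j ∈ r.1, x j = r.2}

/-- A nonempty set `w` of factors is a defining word of the design if the product of the levels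
of the factors in `w` is constant over the runs. -/
def IsDefiningWord {k p : ℕ} (D : Fin k → Fin p → ℤˣ) (w : Finset (Fin p)) : Prop :=
  w.Nonempty ∧ ∃ e : ℤˣ, ∀ i, ∏ j ∈ w, D i j = e

/-- The resolution of a design is the minimal length of a defining word. -/
def HasResolution {k p : ℕ} (D : Fin k → Fin p → ℤˣ) (r : ℕ) : Prop :=
  IsLeast {n | ∃ w : Finset (Fin p), IsDefiningWord D w ∧ w.card = n} r

/-- The model matrix of the main effect model: a column of ones followed by the design matrix. -/
def modelMatrix {k p : ℕ} (D : Fin k → Fin p → ℤˣ) : Matrix (Fin k) (Fin (p + 1)) ℤ :=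
  Matrix.of fun i => Fin.cons 1 fun j => (D i j : ℤ)

/-- The fiber of the configuration `A` (for a model with model matrix `M`, `A = Mᵀ`)
through the frequency vector `y`. -/
def fiber {ι κ : Type*} [Fintype ι] (A : Matrix κ ι ℤ) (y : ι → ℕ) : Set (ι → ℕ) :=
  {x | A *ᵥ (fun i => (x i : ℤ)) = A *ᵥ (fun i => (y i : ℤ))}

/-- Moves for the configuration `A`. -/
def IsMove {ι κ : Type*} [Fintype ι] (A : Matrix κ ι ℤ) (z : ι → ℤ) : Prop := A *ᵥ z = 0

/-- The undirected graph on a set `F` of frequency vectors in which distinct `x` and `y` are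
adjacent iff `y = x + z` or `y = x - z` for some `z ∈ B`. -/
def moveGraph {ι : Type*} (F : Set (ι → ℕ)) (B : Finset (ι → ℤ)) : SimpleGraph F :=
  SimpleGraph.fromRel fun x y => ∃ z ∈ B, ∀ i, (y.1 i : ℤ) = x.1 i + z i

/-- A Markov basis for `A`: a finite set of moves that connects every fiber. A minimal Markov
basis is a Markov basis `B` with `Minimal (IsMarkovBasis A) B`. -/
def IsMarkovBasis {ι κ : Type*} [Fintype ι] (A : Matrix κ ι ℤ) (B : Finset (ι → ℤ)) : Prop :=
  (∀ z ∈ B, IsMove A z) ∧ ∀ y : ι → ℕ, (moveGraph (fiber A y) B).Connected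

/-- An essential fiber: a fiber of degree 2 with more than one element. -/
def IsEssentialFiber {ι κ : Type*} [Fintype ι] (A : Matrix κ ι ℤ) (F : Set (ι → ℕ)) : Prop :=
  (∃ y : ι → ℕ, ∑ i, y i = 2 ∧ F = fiber A y) ∧ F.Nontrivial

/-- The set of essential fibers with exactly `m` elements (used for `m > 0`). -/
def essentialFibers {ι κ : Type*} [Fintype ι] (A : Matrix κ ι ℤ) (m : ℕ) :
    Set (Set (ι → ℕ)) :=
  {F | IsEssentialFiber A F ∧ F.ncard = m}

/-- `C` is a set of differences of elements of `F` that connects `F`. -/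
def ConnectsFiber {ι : Type*} (F : Set (ι → ℕ)) (C : Finset (ι → ℤ)) : Prop :=
  (∀ z ∈ C, ∃ x ∈ F, ∃ y ∈ F, ∀ i, z i = (y i : ℤ) - x i) ∧ (moveGraph F C).Connected

end FactorialDesign

/-! A word of full length holds on the design, and the design has $2^{p-1}$ distinct runs, so the
runs are exactly the sign vectors with $\prod_j u_j=e$ (`exists_prod_eq_iff_of_hasResolution`).
Everything else uses this description.

Generation in degree two (`related_of_mem_fiber`): given `x`, `y` in one fiber, pick runs `a` of `x`
and `b` of `y` and let $S$ be the set where they differ. The correlation with `a` on $S$ is a linear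
combination of the columns, so it has the same total over `x` and over `y`. It is positive at `a`,
so either some run of `x` has negative correlation with `a`, or some run of `y` has negative
correlation with `b`, which is $-a$ on $S$. Such a run opposes `a` (or `b`) at two factors of $S$;
exchanging these two signs is a quadratic move that brings `a` and `b` closer. At distance zero a
common run cancels and the degree drops.

Independence of the fibers (`pair_unique_of_difference`): distinct elements of a degree-two fiber
have disjoint supports, so a nonzero difference determines both elements as its negative and
positive parts, and hence the fiber. The essential fibers can therefore be treated separately
(`minimal_isMarkovBasis_iff`), and a minimal connecting set corresponds to the edges of a spanning
tree (`card_of_minimal_connectsFiber`).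

Counting: the fiber of two runs differing on $S\ne\emptyset$ has $2^{|S|-2}$ elements
(`ncard_fiber_pair`), with $|S|$ even. Essential fibers correspond to their column sums, vectors
over $\{-2,0,2\}$ with zero set $S$, $|S|\ge4$ (`ncard_essentialFibers`). -/

namespace FactorialDesign

/-! ### Graphs defined by moves, and connecting sets of a single fiber. -/

section MoveGraph

variable {ι : Type*}

/-- `y` arises from `x` by adding a move of `B`. -/
def MoveStep (B : Finset (ι → ℤ)) (x y : ι → ℕ) : Prop :=
  ∃ z ∈ B, ∀ i, (y i : ℤ) = x i + z i

/-- Lets connectivity of a degree-two fiber be used inside larger fibers. Working with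
`Relation.EqvGen` on all frequency vectors avoids carrying fiber membership along. -/
theorem eqvGen_moveStep_add {B : Finset (ι → ℤ)} {x y : ι → ℕ} (w : ι → ℕ)
    (h : Relation.EqvGen (MoveStep B) x y) : Relation.EqvGen (MoveStep B) (x + w) (y + w) := by
  induction h with
  | rel x y h =>
    obtain ⟨z, hz, h⟩ := h
    refine .rel _ _ ⟨z, hz, fun i => ?_⟩
    simp only [Pi.add_apply, Nat.cast_add, h i]
    ring
  | refl x => exact .refl _
  | symm x y _ ih => exact ih.symm
  | trans x y z _ _ ih₁ ih₂ => exact ih₁.trans _ _ _ ih₂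

theorem moveGraph_adj {F : Set (ι → ℕ)} {B : Finset (ι → ℤ)} {x y : F} :
    (moveGraph F B).Adj x y ↔ x ≠ y ∧ (MoveStep B x.1 y.1 ∨ MoveStep B y.1 x.1) :=
  SimpleGraph.fromRel_adj _ _ _

theorem eqvGen_of_reachable {F : Set (ι → ℕ)} {B : Finset (ι → ℤ)} {x y : F}
    (h : (moveGraph F B).Reachable x y) : Relation.EqvGen (MoveStep B) x.1 y.1 := by
  rw [SimpleGraph.reachable_iff_reflTransGen] at h
  induction h with
  | refl => exact .refl _
  | tail _ h ih =>
    rcases (moveGraph_adj.1 h).2 with h | h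
    · exact ih.trans _ _ _ (.rel _ _ h)
    · exact ih.trans _ _ _ (.symm _ _ (.rel _ _ h))

/-- `z` is a nonzero difference of elements of `F`. -/
def IsFiberMove (F : Set (ι → ℕ)) (z : ι → ℤ) : Prop :=
  z ≠ 0 ∧ ∃ x ∈ F, ∃ y ∈ F, ∀ i, z i = (y i : ℤ) - x i

open Classical in
/-- The elements of `B` that are nonzero differences of elements of `F`. -/
noncomputable def fiberPart (F : Set (ι → ℕ)) (B : Finset (ι → ℤ)) : Finset (ι → ℤ) :=
  {z ∈ B | IsFiberMove F z}

theorem mem_fiberPart {F : Set (ι → ℕ)} {B : Finset (ι → ℤ)} {z : ι → ℤ} :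
    z ∈ fiberPart F B ↔ z ∈ B ∧ IsFiberMove F z := by
  simp [fiberPart]

theorem fiberPart_subset (F : Set (ι → ℕ)) (B : Finset (ι → ℤ)) : fiberPart F B ⊆ B :=
  fun _ hz => (mem_fiberPart.1 hz).1

theorem moveGraph_mono (F : Set (ι → ℕ)) {B B' : Finset (ι → ℤ)} (h : B ⊆ B') :
    moveGraph F B ≤ moveGraph F B' := by
  intro x y hxy
  rw [moveGraph_adj] at hxy ⊢
  exact ⟨hxy.1, hxy.2.imp (fun ⟨z, hz, e⟩ => ⟨z, h hz, e⟩) (fun ⟨z, hz, e⟩ => ⟨z, h hz, e⟩)⟩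

/-- An edge inside `F` is always labelled by a nonzero difference of elements of `F`, so other moves
play no role for `F`. -/
theorem moveGraph_fiberPart (F : Set (ι → ℕ)) (B : Finset (ι → ℤ)) :
    moveGraph F (fiberPart F B) = moveGraph F B := by
  refine le_antisymm (moveGraph_mono F (fiberPart_subset F B)) fun x y hxy => ?_
  have key : ∀ x y : F, x ≠ y → MoveStep B x.1 y.1 → MoveStep (fiberPart F B) x.1 y.1 := by
    rintro x y hne ⟨z, hz, h⟩
    refine ⟨z, mem_fiberPart.2 ⟨hz, ?_, x.1, x.2, y.1, y.2, fun i => by rw [h i]; ring⟩, h⟩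
    rintro rfl
    exact hne (Subtype.ext (funext fun i => by simpa [eq_comm] using h i))
  rw [moveGraph_adj] at hxy ⊢
  exact ⟨hxy.1, hxy.2.imp (key x y hxy.1) (key y x hxy.1.symm)⟩

theorem connectsFiber_fiberPart {F : Set (ι → ℕ)} {B : Finset (ι → ℤ)}
    (h : (moveGraph F B).Connected) : ConnectsFiber F (fiberPart F B) :=
  ⟨fun _ hz => (mem_fiberPart.1 hz).2.2, by rwa [moveGraph_fiberPart]⟩

/-- The zero difference is allowed in `ConnectsFiber` but labels no edge, so minimality excludes it.
-/
theorem fiberPart_eq_of_minimal {F : Set (ι → ℕ)} {C : Finset (ι → ℤ)}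
    (h : Minimal (ConnectsFiber F) C) : fiberPart F C = C :=
  (fiberPart_subset F C).antisymm
    (h.2 (connectsFiber_fiberPart h.1.2) (fiberPart_subset F C))

theorem exists_minimal_connectsFiber {F : Set (ι → ℕ)} (hF : F.Finite) (hne : F.Nonempty) :
    ∃ C, Minimal (ConnectsFiber F) C := by
  classical
  have : ∃ C, ConnectsFiber F C := by
    refine ⟨(hF.toFinset ×ˢ hF.toFinset).image fun q i => (q.2 i : ℤ) - q.1 i, ?_, ?_⟩
    · intro z hz
      simp only [Finset.mem_image, Finset.mem_product, Set.Finite.mem_toFinset] at hz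
      obtain ⟨q, ⟨h₁, h₂⟩, rfl⟩ := hz
      exact ⟨q.1, h₁, q.2, h₂, fun _ => rfl⟩
    · have := hne.to_subtype
      refine ⟨fun x y => ?_⟩
      by_cases hxy : x = y
      · rw [hxy]
      · refine SimpleGraph.Adj.reachable (moveGraph_adj.2 ⟨hxy, .inl
          ⟨fun i => (y.1 i : ℤ) - x.1 i, ?_, fun i => ?_⟩⟩)
        · simp only [Finset.mem_image, Finset.mem_product, Set.Finite.mem_toFinset]
          exact ⟨(x.1, y.1), ⟨x.2, y.2⟩, rfl⟩
        · ring
  obtain ⟨C, hC⟩ := this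
  exact (exists_minimal_le_of_wellFoundedLT _ C hC).imp fun _ h => h.2

/-- If every difference of elements of `F` arises from only one pair, then a minimal connecting
set of differences is in bijection with the edges of a spanning tree. -/
theorem card_of_minimal_connectsFiber {F : Set (ι → ℕ)} (hF : F.Finite)
    (hpair : ∀ x ∈ F, ∀ y ∈ F, ∀ x' ∈ F, ∀ y' ∈ F, x ≠ y →
      (∀ i, (y i : ℤ) - x i = y' i - x' i) → x = x' ∧ y = y')
    {C : Finset (ι → ℤ)} (hC : Minimal (ConnectsFiber F) C) : C.card + 1 = F.ncard := by
  classical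
  have := hF.fintype
  obtain ⟨T, hT, htree⟩ := hC.1.2.exists_isTree_le
  -- Each tree edge is labelled by a move of `C`, in whichever direction that move traverses it.
  have key : ∀ e : T.edgeSet, ∃ z ∈ C, ∃ x y : F, e.1 = s(x, y) ∧ x ≠ y ∧
      ∀ i, z i = (y.1 i : ℤ) - x.1 i := by
    rintro ⟨e, he⟩
    induction e with
    | _ x y =>
      obtain ⟨hne, h | h⟩ := moveGraph_adj.1 (hT he)
      · obtain ⟨z, hz, h⟩ := h
        exact ⟨z, hz, x, y, rfl, hne, fun i => by rw [h i]; ring⟩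
      · obtain ⟨z, hz, h⟩ := h
        exact ⟨z, hz, y, x, Sym2.eq_swap, hne.symm, fun i => by rw [h i]; ring⟩
  choose z hz x y hxy hne hdiff using key
  have hinj : Function.Injective z := by
    intro e e' hee
    obtain ⟨h₁, h₂⟩ := hpair _ (x e).2 _ (y e).2 _ (x e').2 _ (y e').2
      (fun h => hne e (Subtype.ext h)) (fun i => by rw [← hdiff, ← hdiff, hee])
    apply Subtype.ext
    rw [hxy e, hxy e', Subtype.ext h₁, Subtype.ext h₂]
  have hsub : Finset.univ.image z ⊆ C := by
    intro w hw
    obtain ⟨e, -, rfl⟩ := Finset.mem_image.1 hw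
    exact hz e
  have hle : T ≤ moveGraph F (Finset.univ.image z) := by
    intro a b hab
    let e : T.edgeSet := ⟨s(a, b), hab⟩
    have hstep : MoveStep (Finset.univ.image z) (x e).1 (y e).1 :=
      ⟨z e, Finset.mem_image_of_mem _ (Finset.mem_univ _), fun i => by rw [hdiff]; ring⟩
    rw [moveGraph_adj]
    refine ⟨hab.ne, ?_⟩
    rcases Sym2.eq_iff.1 (hxy e) with ⟨h₁, h₂⟩ | ⟨h₁, h₂⟩
    · rw [h₁, h₂]; exact .inl hstep
    · rw [h₁, h₂]; exact .inr hstep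
  -- The labels of the tree already connect `F`, so minimality leaves no other moves; distinct edges
  -- have distinct labels by `hinj`.
  have hCeq : C = Finset.univ.image z :=
    (hC.2 ⟨fun w hw => hC.1.1 w (hsub hw), htree.connected.mono hle⟩ hsub).antisymm hsub
  rw [hCeq, Finset.card_image_of_injective _ hinj, Finset.card_univ, ← Nat.card_coe_set_eq,
    Nat.card_eq_fintype_card, ← htree.card_edgeFinset, SimpleGraph.edgeFinset_card]

end MoveGraph

/-! ### Fibers, translation, and connectivity as an equivalence relation. -/

section Fibers

variable {ι κ : Type*} [Fintype ι] {A : Matrix κ ι ℤ}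

theorem self_mem_fiber (y : ι → ℕ) : y ∈ fiber A y := rfl

theorem fiber_eq_of_mem {x y : ι → ℕ} (h : x ∈ fiber A y) : fiber A x = fiber A y := by
  ext z
  change _ = _ ↔ _ = _
  rw [show A *ᵥ (fun i => (x i : ℤ)) = A *ᵥ (fun i => (y i : ℤ)) from h]

theorem mem_fiber_comm {x y : ι → ℕ} : x ∈ fiber A y ↔ y ∈ fiber A x :=
  ⟨fun h => Eq.symm h, fun h => Eq.symm h⟩

theorem mem_fiber_iff_isMove {x y : ι → ℕ} :
    x ∈ fiber A y ↔ IsMove A (fun i => (x i : ℤ) - y i) := by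
  have : (fun i => (x i : ℤ) - y i) = (fun i => (x i : ℤ)) - fun i => (y i : ℤ) := rfl
  rw [IsMove, this, Matrix.mulVec_sub, sub_eq_zero]
  rfl

theorem add_mem_fiber_add {u v : ι → ℕ} (w : ι → ℕ) :
    u + w ∈ fiber A (v + w) ↔ u ∈ fiber A v := by
  simp [mem_fiber_iff_isMove]

theorem MoveStep.mem_fiber {B : Finset (ι → ℤ)} (hB : ∀ z ∈ B, IsMove A z) {x y : ι → ℕ}
    (h : MoveStep B x y) : y ∈ fiber A x := by
  obtain ⟨z, hz, h⟩ := h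
  rw [mem_fiber_iff_isMove]
  convert hB z hz using 1
  ext i
  rw [h i]
  ring

/-- The membership equivalence is part of the induction because transitivity needs the intermediate
vector to lie in the fiber. -/
theorem reachable_of_eqvGen {B : Finset (ι → ℤ)} (hB : ∀ z ∈ B, IsMove A z) {w : ι → ℕ}
    {x y : ι → ℕ} (h : Relation.EqvGen (MoveStep B) x y) :
    (x ∈ fiber A w ↔ y ∈ fiber A w) ∧
      ∀ (hx : x ∈ fiber A w) (hy : y ∈ fiber A w),
        (moveGraph (fiber A w) B).Reachable ⟨x, hx⟩ ⟨y, hy⟩ := by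
  induction h with
  | rel x y h =>
    refine ⟨?_, fun hx hy => ?_⟩
    · rw [mem_fiber_comm, @mem_fiber_comm _ _ _ _ y, fiber_eq_of_mem (h.mem_fiber hB)]
    · by_cases hxy : x = y
      · subst hxy; exact .refl _
      · exact SimpleGraph.Adj.reachable
          (moveGraph_adj.2 ⟨fun h => hxy (congrArg Subtype.val h), .inl h⟩)
  | refl x => exact ⟨Iff.rfl, fun _ _ => .refl _⟩
  | symm x y _ ih => exact ⟨ih.1.symm, fun hx hy => (ih.2 hy hx).symm⟩
  | trans x y z _ _ ih₁ ih₂ =>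
    exact ⟨ih₁.1.trans ih₂.1,
      fun hx hz => (ih₁.2 hx (ih₁.1.1 hx)).trans (ih₂.2 (ih₁.1.1 hx) hz)⟩

theorem moveGraph_fiber_connected_iff {B : Finset (ι → ℤ)} (hB : ∀ z ∈ B, IsMove A z)
    {w : ι → ℕ} : (moveGraph (fiber A w) B).Connected ↔
      ∀ x ∈ fiber A w, ∀ y ∈ fiber A w, Relation.EqvGen (MoveStep B) x y := by
  constructor
  · intro h x hx y hy
    exact eqvGen_of_reachable (h.preconnected ⟨x, hx⟩ ⟨y, hy⟩)
  · intro h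
    have : Nonempty (fiber A w) := ⟨⟨w, self_mem_fiber w⟩⟩
    exact ⟨fun x y => (reachable_of_eqvGen hB (h x.1 x.2 y.1 y.2)).2 x.2 y.2⟩

theorem ConnectsFiber.isMove {w : ι → ℕ} {C : Finset (ι → ℤ)}
    (h : ConnectsFiber (fiber A w) C) : ∀ z ∈ C, IsMove A z := by
  intro z hz
  obtain ⟨x, hx, y, hy, e⟩ := h.1 z hz
  rw [funext e, ← mem_fiber_iff_isMove, fiber_eq_of_mem hx]
  exact hy

end Fibers

/-! ### Minimal Markov bases decompose over the essential fibers. -/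

section Minimality

variable {ι κ : Type*} [Fintype ι] {A : Matrix κ ι ℤ}

theorem connected_of_isMarkovBasis {B : Finset (ι → ℤ)} (hB : IsMarkovBasis A B)
    {F : Set (ι → ℕ)} (hF : IsEssentialFiber A F) : (moveGraph F B).Connected := by
  obtain ⟨⟨y, -, rfl⟩, -⟩ := hF
  exact hB.2 y

/-- If Markov bases are detected on essential fibers and nonzero differences of elements of
distinct essential fibers are distinct, then the minimal Markov bases are the unions of minimal
connecting sets of the essential fibers. -/
theorem minimal_isMarkovBasis_iff
    (hE : ∀ B : Finset (ι → ℤ), (∀ z ∈ B, IsMove A z) →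
      (∀ F, IsEssentialFiber A F → (moveGraph F B).Connected) → IsMarkovBasis A B)
    (hU : ∀ F F', IsEssentialFiber A F → IsEssentialFiber A F' → ∀ z, IsFiberMove F z →
      IsFiberMove F' z → F = F')
    (B : Finset (ι → ℤ)) :
    Minimal (IsMarkovBasis A) B ↔ ∃ C : Set (ι → ℕ) → Finset (ι → ℤ),
      (∀ F, IsEssentialFiber A F → Minimal (ConnectsFiber F) (C F)) ∧
      (B : Set (ι → ℤ)) = ⋃ F ∈ {F | IsEssentialFiber A F}, (C F : Set (ι → ℤ)) := by
  classical
  constructor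
  · intro hB
    have hmin : ∀ F, IsEssentialFiber A F → Minimal (ConnectsFiber F) (fiberPart F B) := by
      intro F hF
      refine ⟨connectsFiber_fiberPart (connected_of_isMarkovBasis hB.1 hF), fun C' hC' hle => ?_⟩
      -- Exchange: the moves of `B` belonging to `F` are replaced by the smaller connecting set
      -- `C'`. By `hU` no other essential fiber loses a move, so the result is a Markov basis and
      -- equals `B`.
      have hsub : B \ fiberPart F B ∪ C' ⊆ B :=
        Finset.union_subset Finset.sdiff_subset (hle.trans (fiberPart_subset F B))
      have hM : IsMarkovBasis A (B \ fiberPart F B ∪ C') := by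
        refine hE _ (fun z hz => hB.1.1 z (hsub hz)) fun F' hF' => ?_
        by_cases hFF : F' = F
        · subst hFF
          exact hC'.2.mono (moveGraph_mono _ Finset.subset_union_right)
        · have h := connected_of_isMarkovBasis hB.1 hF'
          rw [← moveGraph_fiberPart] at h
          refine h.mono (moveGraph_mono _ fun z hz => ?_)
          rw [mem_fiberPart] at hz
          refine Finset.mem_union_left _ (Finset.mem_sdiff.2 ⟨hz.1, fun hz' => hFF ?_⟩)
          exact hU F' F hF' hF z hz.2 (mem_fiberPart.1 hz').2
      intro z hz
      rcases Finset.mem_union.1 (hB.2 hM hsub (fiberPart_subset F B hz)) with h | h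
      · exact absurd hz (Finset.mem_sdiff.1 h).2
      · exact h
    refine ⟨fun F => fiberPart F B, hmin, ?_⟩
    -- Moves that belong to no essential fiber can be discarded, so by minimality there are none.
    let B' := B.filter fun z => ∃ F, IsEssentialFiber A F ∧ IsFiberMove F z
    have hB' : IsMarkovBasis A B' := by
      refine hE _ (fun z hz => hB.1.1 z (Finset.filter_subset _ _ hz)) fun F hF => ?_
      have h := connected_of_isMarkovBasis hB.1 hF
      rw [← moveGraph_fiberPart] at h
      refine h.mono (moveGraph_mono _ fun z hz => ?_)
      rw [mem_fiberPart] at hz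
      exact Finset.mem_filter.2 ⟨hz.1, F, hF, hz.2⟩
    ext z
    simp only [Set.mem_iUnion, Finset.mem_coe, mem_fiberPart, Set.mem_ofPred_eq, exists_prop]
    constructor
    · intro hz
      obtain ⟨h, F, hF, hzF⟩ := Finset.mem_filter.1 (hB.2 hB' (Finset.filter_subset _ _) hz)
      exact ⟨F, hF, h, hzF⟩
    · rintro ⟨F, hF, h, -⟩
      exact h
  · rintro ⟨C, hC, hBC⟩
    have hmem : ∀ z, z ∈ B ↔ ∃ F, IsEssentialFiber A F ∧ z ∈ C F := by
      intro z
      rw [← Finset.mem_coe, hBC]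
      simp
    have hmove : ∀ z ∈ B, IsMove A z := by
      intro z hz
      obtain ⟨F, hF, hz⟩ := (hmem z).1 hz
      have h := (hC F hF).1
      obtain ⟨⟨y, -, rfl⟩, -⟩ := hF
      exact h.isMove z hz
    refine ⟨hE B hmove fun F hF => (hC F hF).1.2.mono
      (moveGraph_mono _ fun z hz => (hmem z).2 ⟨F, hF, hz⟩), fun B' hB' hle => ?_⟩
    intro z hz
    obtain ⟨F, hF, hz⟩ := (hmem z).1 hz
    -- A move of `B'` that belongs to `F` comes from some `C F'`, and `hU` forces `F' = F`;
    -- minimality of `C F` then shows that nothing of it is missing from `B'`.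
    have hsub : fiberPart F B' ⊆ C F := by
      intro w hw
      rw [mem_fiberPart] at hw
      obtain ⟨F', hF', hw'⟩ := (hmem w).1 (hle hw.1)
      have hw'' := hw'
      rw [← fiberPart_eq_of_minimal (hC F' hF'), mem_fiberPart] at hw''
      rwa [hU F F' hF hF' w hw.2 hw''.2]
    exact fiberPart_subset _ _ ((hC F hF).2
      (connectsFiber_fiberPart (connected_of_isMarkovBasis hB' hF)) hsub hz)

theorem card_eq_sum_of_eq_iUnion
    (hU : ∀ F F', IsEssentialFiber A F → IsEssentialFiber A F' → ∀ z, IsFiberMove F z →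
      IsFiberMove F' z → F = F')
    (hfin : {F | IsEssentialFiber A F}.Finite) {B : Finset (ι → ℤ)}
    {C : Set (ι → ℕ) → Finset (ι → ℤ)}
    (hC : ∀ F, IsEssentialFiber A F → Minimal (ConnectsFiber F) (C F))
    (hB : (B : Set (ι → ℤ)) = ⋃ F ∈ {F | IsEssentialFiber A F}, (C F : Set (ι → ℤ))) :
    B.card = ∑ F ∈ hfin.toFinset, (C F).card := by
  classical
  have : B = hfin.toFinset.biUnion C := by
    apply Finset.coe_injective
    rw [hB, Finset.coe_biUnion]
    simp
  rw [this, Finset.card_biUnion]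
  intro F hF F' hF' hne
  rw [Finset.mem_coe, Set.Finite.mem_toFinset] at hF hF'
  rw [Function.onFun, Finset.disjoint_left]
  intro z hz hz'
  rw [← fiberPart_eq_of_minimal (hC _ hF), mem_fiberPart] at hz
  rw [← fiberPart_eq_of_minimal (hC _ hF'), mem_fiberPart] at hz'
  exact hne (hU F F' hF hF' z hz.2 hz'.2)

end Minimality

/-! ### Frequency vectors of degree one and two. -/

section Pairs

variable {ι : Type*}

theorem exists_eq_single_add [DecidableEq ι] {x : ι → ℕ} {a : ι} (h : 0 < x a) :
    ∃ x' : ι → ℕ, x = Pi.single a 1 + x' := by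
  refine ⟨x - Pi.single a 1, funext fun i => ?_⟩
  by_cases hi : i = a
  · subst hi
    simp only [Pi.add_apply, Pi.sub_apply, Pi.single_eq_same]
    lia
  · simp [Pi.single_eq_of_ne hi]

theorem exists_pos_of_sum_pos [Fintype ι] {x : ι → ℕ} (h : 0 < ∑ i, x i) : ∃ a, 0 < x a := by
  obtain ⟨a, -, ha⟩ := Finset.exists_ne_zero_of_sum_ne_zero h.ne'
  exact ⟨a, Nat.pos_of_ne_zero ha⟩

variable [Fintype ι] [DecidableEq ι]

theorem sum_single_add (a : ι) (x : ι → ℕ) :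
    ∑ i, (Pi.single a 1 + x : ι → ℕ) i = 1 + ∑ i, x i := by
  simp [Finset.sum_add_distrib]

theorem exists_eq_single_of_sum_eq_one {x : ι → ℕ} (h : ∑ i, x i = 1) :
    ∃ a, x = Pi.single a 1 := by
  obtain ⟨a, ha⟩ := exists_pos_of_sum_pos (x := x) (by lia)
  obtain ⟨x', rfl⟩ := exists_eq_single_add ha
  rw [sum_single_add] at h
  have : x' = 0 := funext fun i =>
    (Finset.sum_eq_zero_iff.1 (show ∑ i, x' i = 0 by lia)) i (Finset.mem_univ i)
  exact ⟨a, by rw [this, add_zero]⟩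

theorem exists_eq_pair_of_sum_eq_two {x : ι → ℕ} (h : ∑ i, x i = 2) :
    ∃ a b, x = Pi.single a 1 + Pi.single b 1 := by
  obtain ⟨a, ha⟩ := exists_pos_of_sum_pos (x := x) (by lia)
  obtain ⟨x', rfl⟩ := exists_eq_single_add ha
  rw [sum_single_add] at h
  obtain ⟨b, rfl⟩ := exists_eq_single_of_sum_eq_one (show ∑ i, x' i = 1 by lia)
  exact ⟨a, b, rfl⟩

theorem sum_pair (a b : ι) :
    ∑ i, (Pi.single a 1 + Pi.single b 1 : ι → ℕ) i = 2 := by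
  simp [Finset.sum_add_distrib]

end Pairs

/-! ### Sign vectors, their disagreement sets, and sign changes. -/

section Signs

theorem Int.units_cast_mul_eq (u v : ℤˣ) : (u : ℤ) * v = if u = v then 1 else -1 := by
  revert u v
  decide

variable {J : Type*} [Fintype J]

/-- The set of factors on which two runs differ. -/
def diffSet (u v : J → ℤˣ) : Finset J := Finset.univ.filter fun j => u j ≠ v j

theorem mem_diffSet {u v : J → ℤˣ} {j : J} : j ∈ diffSet u v ↔ u j ≠ v j := by
  simp [diffSet]

theorem sum_diffSet_mul_self (u v : J → ℤˣ) :
    ∑ j ∈ diffSet u v, (u j : ℤ) * u j = (diffSet u v).card := by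
  simp

theorem diffSet_comm (u v : J → ℤˣ) : diffSet u v = diffSet v u := by
  ext j
  rw [mem_diffSet, mem_diffSet, ne_comm]

/-- If `w` has negative correlation with `u` on a set of at least two factors, then it differs
from `u` at two of them. -/
theorem exists_pair_ne_of_sum_neg {S : Finset J} (hS : 2 ≤ S.card) {u w : J → ℤˣ}
    (h : ∑ j ∈ S, (w j : ℤ) * u j < 0) :
    ∃ T ⊆ S, T.card = 2 ∧ T ⊆ diffSet u w := by
  have hle : 2 ≤ (S.filter fun j => u j ≠ w j).card := by
    by_contra! hlt
    -- At most one disagreement would give correlation at least $|S|-2\ge0$.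
    have hsum : ∑ j ∈ S, (w j : ℤ) * u j = S.card - 2 * (S.filter fun j => u j ≠ w j).card := by
      rw [Finset.card_filter, Finset.card_eq_sum_ones]
      push_cast
      rw [Finset.mul_sum, ← Finset.sum_sub_distrib]
      refine Finset.sum_congr rfl fun j _ => ?_
      rw [Int.units_cast_mul_eq]
      by_cases hj : u j = w j
      · simp [hj]
      · simp [hj, Ne.symm hj]
    lia
  obtain ⟨T, hT, hcard⟩ := Finset.exists_subset_card_eq hle
  refine ⟨T, hT.trans (Finset.filter_subset _ _), hcard, fun j hj => ?_⟩
  exact mem_diffSet.2 (Finset.mem_filter.1 (hT hj)).2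

variable [DecidableEq J]

theorem prod_update_neg (u : J → ℤˣ) (j : J) :
    ∏ i, Function.update u j (-u j) i = -∏ i, u i := by
  rw [Finset.prod_update_of_mem (Finset.mem_univ j), neg_mul, ← Finset.prod_sdiff
    (Finset.subset_univ {j}), Finset.prod_singleton, mul_comm]

theorem card_signs_off {p : ℕ} (U : Finset (Fin p)) (a : Fin p → ℤˣ) :
    (Finset.univ.filter fun u : Fin p → ℤˣ => ∀ j ∉ U, u j = a j).card = 2 ^ U.card := by
  have : (Finset.univ.filter fun u : Fin p → ℤˣ => ∀ j ∉ U, u j = a j) =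
      Fintype.piFinset fun j => if j ∈ U then Finset.univ else {a j} := by
    ext u
    simp only [Finset.mem_filter, Finset.mem_univ, true_and, Fintype.mem_piFinset]
    refine forall_congr' fun j => ?_
    by_cases hj : j ∈ U <;> simp [hj, Int.units_eq_one_or]
  rw [this, Fintype.card_piFinset]
  simp [apply_ite Finset.card]

/-- Among the sign vectors that agree with `a` off the nonempty set `U`, exactly half have
product `e`. -/
theorem card_signs_off_prod_eq {p : ℕ} {U : Finset (Fin p)} (hU : U.Nonempty) (a : Fin p → ℤˣ) (e : ℤˣ) :
    (Finset.univ.filter fun u : Fin p → ℤˣ => (∀ j ∉ U, u j = a j) ∧ ∏ j, u j = e).card =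
      2 ^ (U.card - 1) := by
  obtain ⟨j₀, hj₀⟩ := hU
  -- Changing the sign at `j₀` injects the vectors of product `e` into those of product `-e`; using
  -- this for both signs makes the two classes equinumerous.
  have hle : ∀ e : ℤˣ,
      (Finset.univ.filter fun u : Fin p → ℤˣ => (∀ j ∉ U, u j = a j) ∧ ∏ j, u j = e).card ≤
      (Finset.univ.filter fun u : Fin p → ℤˣ => (∀ j ∉ U, u j = a j) ∧ ∏ j, u j = -e).card := by
    intro e
    refine Finset.card_le_card_of_injOn (fun u => Function.update u j₀ (-u j₀)) ?_ ?_
    · intro u hu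
      simp only [Finset.coe_filter, Finset.mem_univ, true_and, Set.mem_ofPred_eq] at hu ⊢
      refine ⟨fun j hj => ?_, by rw [prod_update_neg, hu.2]⟩
      rw [Function.update_of_ne (by rintro rfl; exact hj hj₀), hu.1 j hj]
    · intro u _ v _ huv
      funext j
      have := congrFun huv j
      by_cases hj : j = j₀
      · subst hj; simpa using this
      · simpa [hj] using this
  have hsum := Finset.card_filter_add_card_filter_not
    (s := Finset.univ.filter fun u : Fin p → ℤˣ => ∀ j ∉ U, u j = a j) (fun u => ∏ j, u j = e)
  rw [card_signs_off, Finset.filter_filter, Finset.filter_filter] at hsum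
  have hneg : (Finset.univ.filter fun u : Fin p → ℤˣ => (∀ j ∉ U, u j = a j) ∧ ¬∏ j, u j = e) =
      Finset.univ.filter fun u : Fin p → ℤˣ => (∀ j ∉ U, u j = a j) ∧ ∏ j, u j = -e := by
    refine Finset.filter_congr fun u _ => and_congr_right fun _ => ?_
    exact Int.units_ne_iff_eq_neg
  rw [hneg] at hsum
  have h₁ := hle e
  have h₂ := hle (-e)
  rw [neg_neg] at h₂
  have hpos : 0 < U.card := Finset.card_pos.2 ⟨j₀, hj₀⟩
  obtain ⟨n, hn⟩ : ∃ n, U.card = n + 1 := ⟨U.card - 1, by lia⟩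
  rw [hn, pow_succ] at hsum
  rw [hn, Nat.add_sub_cancel]
  lia

/-- Change the sign of `u` on `T`. -/
def flipOn (T : Finset J) (u : J → ℤˣ) : J → ℤˣ := fun j => if j ∈ T then -u j else u j

theorem prod_flipOn (T : Finset J) (u : J → ℤˣ) :
    ∏ j, flipOn T u j = (-1) ^ T.card * ∏ j, u j := by
  have : ∀ j, flipOn T u j = (if j ∈ T then -1 else 1) * u j := by
    intro j
    by_cases hj : j ∈ T <;> simp [flipOn, hj]
  simp_rw [this, Finset.prod_mul_distrib]
  simp

theorem prod_flipOn_of_even {T : Finset J} (hT : Even T.card) (u : J → ℤˣ) :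
    ∏ j, flipOn T u j = ∏ j, u j := by
  rw [prod_flipOn, hT.neg_one_pow, one_mul]

theorem flipOn_diffSet (u v : J → ℤˣ) : flipOn (diffSet u v) u = v := by
  funext j
  by_cases hj : u j = v j
  · simp [flipOn, mem_diffSet, hj]
  · simp [flipOn, mem_diffSet, Int.units_ne_iff_eq_neg.1 hj]

theorem diffSet_flipOn (T : Finset J) (u : J → ℤˣ) : diffSet u (flipOn T u) = T := by
  ext j
  by_cases hj : j ∈ T <;> simp [flipOn, mem_diffSet, hj]

theorem even_card_diffSet {u v : J → ℤˣ} (h : ∏ j, u j = ∏ j, v j) :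
    Even (diffSet u v).card := by
  by_contra hodd
  have := prod_flipOn (diffSet u v) u
  rw [flipOn_diffSet, h, (Nat.not_even_iff_odd.1 hodd).neg_one_pow, neg_one_mul] at this
  exact Int.units_ne_iff_eq_neg.2 this rfl

end Signs

/-! ### Degree-two fibers of a design and uniqueness of differences. -/

section Design

variable {k p : ℕ} {D : Fin k → Fin p → ℤˣ} {e : ℤˣ}

theorem mem_fiber_modelMatrix {x y : Fin k → ℕ} :
    x ∈ fiber (modelMatrix D)ᵀ y ↔ ∑ i, x i = ∑ i, y i ∧
      ∀ j, ∑ i, (x i : ℤ) * D i j = ∑ i, (y i : ℤ) * D i j := by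
  change _ = _ ↔ _
  rw [funext_iff, Fin.forall_fin_succ]
  refine and_congr ?_ (forall_congr' fun j => ?_)
  · simp only [Matrix.mulVec, dotProduct, Matrix.transpose_apply, modelMatrix, Matrix.of_apply,
      Fin.cons_zero, one_mul]
    norm_cast
  · simp only [Matrix.mulVec, dotProduct, Matrix.transpose_apply, modelMatrix, Matrix.of_apply,
      Fin.cons_succ, mul_comm]

theorem sum_pair_mul (a b : Fin k) (f : Fin k → ℤ) :
    ∑ i, (((Pi.single a 1 + Pi.single b 1 : Fin k → ℕ) i : ℕ) : ℤ) * f i = f a + f b := by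
  simp [add_mul, Finset.sum_add_distrib, Pi.single_apply]

theorem pair_mem_fiber_pair {a b c d : Fin k} :
    (Pi.single a 1 + Pi.single b 1 : Fin k → ℕ) ∈
      fiber (modelMatrix D)ᵀ (Pi.single c 1 + Pi.single d 1) ↔
      ∀ j, (D a j : ℤ) + D b j = D c j + D d j := by
  rw [mem_fiber_modelMatrix, sum_pair, sum_pair]
  simp only [sum_pair_mul, true_and]

theorem eq_of_mem_fiber_of_sum_eq_one (hD : Function.Injective D) {x y : Fin k → ℕ}
    (hx : ∑ i, x i = 1) (h : x ∈ fiber (modelMatrix D)ᵀ y) : x = y := by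
  rw [mem_fiber_modelMatrix, hx] at h
  obtain ⟨a, rfl⟩ := exists_eq_single_of_sum_eq_one hx
  obtain ⟨b, rfl⟩ := exists_eq_single_of_sum_eq_one h.1.symm
  congr 1
  refine hD (funext fun j => Units.ext ?_)
  simpa [Pi.single_apply] using h.2 j

/-- Distinct elements of a fiber of degree two have disjoint supports. -/
theorem eq_of_mem_fiber_of_pos (hD : Function.Injective D) {x y : Fin k → ℕ}
    (hx : ∑ i, x i = 2) (h : x ∈ fiber (modelMatrix D)ᵀ y) {i : Fin k}
    (hxi : 0 < x i) (hyi : 0 < y i) : x = y := by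
  obtain ⟨x', rfl⟩ := exists_eq_single_add hxi
  obtain ⟨y', rfl⟩ := exists_eq_single_add hyi
  rw [add_comm _ x', add_comm _ y', add_mem_fiber_add] at h
  rw [sum_single_add] at hx
  rw [eq_of_mem_fiber_of_sum_eq_one hD (by lia) h]

/-- By disjointness of supports, `x` and `y` are the negative and positive parts of `y - x`. -/
theorem pair_unique_of_difference (hD : Function.Injective D) {x y x' y' : Fin k → ℕ}
    (hx : ∑ i, x i = 2) (hx' : ∑ i, x' i = 2) (hxy : x ∈ fiber (modelMatrix D)ᵀ y)
    (hxy' : x' ∈ fiber (modelMatrix D)ᵀ y') (hne : x ≠ y)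
    (h : ∀ i, (y i : ℤ) - x i = y' i - x' i) : x = x' ∧ y = y' := by
  have hne' : x' ≠ y' := by
    rintro rfl
    exact hne (funext fun i => by have := h i; lia)
  have key : ∀ i, x i = x' i ∧ y i = y' i := by
    intro i
    have h₁ : ¬(0 < x i ∧ 0 < y i) := fun h => hne (eq_of_mem_fiber_of_pos hD hx hxy h.1 h.2)
    have h₂ : ¬(0 < x' i ∧ 0 < y' i) :=
      fun h => hne' (eq_of_mem_fiber_of_pos hD hx' hxy' h.1 h.2)
    have := h i
    lia
  exact ⟨funext fun i => (key i).1, funext fun i => (key i).2⟩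

theorem sum_eq_of_mem_fiber {x y : Fin k → ℕ} (h : x ∈ fiber (modelMatrix D)ᵀ y) :
    ∑ i, x i = ∑ i, y i := (mem_fiber_modelMatrix.1 h).1

theorem IsEssentialFiber.eq_of_isFiberMove (hD : Function.Injective D) {F F' : Set (Fin k → ℕ)}
    (hF : IsEssentialFiber (modelMatrix D)ᵀ F) (hF' : IsEssentialFiber (modelMatrix D)ᵀ F')
    {z : Fin k → ℤ} (hz : IsFiberMove F z) (hz' : IsFiberMove F' z) : F = F' := by
  obtain ⟨⟨w, hw, rfl⟩, -⟩ := hF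
  obtain ⟨⟨w', hw', rfl⟩, -⟩ := hF'
  obtain ⟨hz0, x, hx, y, hy, h⟩ := hz
  obtain ⟨-, x', hx', y', hy', h'⟩ := hz'
  have hxy : x ∈ fiber (modelMatrix D)ᵀ y := by rwa [fiber_eq_of_mem hy]
  have hxy' : x' ∈ fiber (modelMatrix D)ᵀ y' := by rwa [fiber_eq_of_mem hy']
  have := pair_unique_of_difference hD ((sum_eq_of_mem_fiber hx).trans hw)
    ((sum_eq_of_mem_fiber hx').trans hw') hxy hxy' ?_ (fun i => by rw [← h, ← h'])
  · rw [← fiber_eq_of_mem hx, ← fiber_eq_of_mem hx', this.1]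
  · rintro rfl
    exact hz0 (funext fun i => by rw [h i]; simp)

theorem finite_sum_eq (n : ℕ) : {x : Fin k → ℕ | ∑ i, x i = n}.Finite := by
  refine (Set.finite_Iic (fun _ : Fin k => n)).subset fun x hx i => ?_
  rw [← show ∑ i, x i = n from hx]
  exact Finset.single_le_sum (fun _ _ => Nat.zero_le _) (Finset.mem_univ i)

theorem finite_fiber (y : Fin k → ℕ) : (fiber (modelMatrix D)ᵀ y).Finite :=
  (finite_sum_eq (∑ i, y i)).subset fun _ hx => sum_eq_of_mem_fiber hx

theorem finite_isEssentialFiber :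
    {F : Set (Fin k → ℕ) | IsEssentialFiber (modelMatrix D)ᵀ F}.Finite := by
  refine ((finite_sum_eq 2).image (fiber (modelMatrix D)ᵀ)).subset ?_
  rintro F ⟨⟨y, hy, rfl⟩, -⟩
  exact ⟨y, hy, rfl⟩

/-! ### Generation of all moves in degree two. -/

/-- The quadratic move that replaces the runs `a`, `c`, differing on `T`, by the runs obtained
from them by changing signs on `T`. -/
theorem exists_flip_pair (hR : ∀ u, (∃ i, D i = u) ↔ ∏ j, u j = e) {x : Fin k → ℕ}
    {a c : Fin k} (ha : 0 < x a) (hc : 0 < x c) {T : Finset (Fin p)} (hT : Even T.card)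
    (hT0 : T.Nonempty) (hTd : T ⊆ diffSet (D a) (D c)) :
    ∃ a' u v w, D a' = flipOn T (D a) ∧ x = u + w ∧ ∑ i, u i = 2 ∧
      u ∈ fiber (modelMatrix D)ᵀ v ∧ 0 < v a' := by
  obtain ⟨a', ha'⟩ := (hR (flipOn T (D a))).2
    (by rw [prod_flipOn_of_even hT]; exact (hR _).1 ⟨a, rfl⟩)
  obtain ⟨c', hc'⟩ := (hR (flipOn T (D c))).2
    (by rw [prod_flipOn_of_even hT]; exact (hR _).1 ⟨c, rfl⟩)
  -- Needed so that `c` is still in the support after one copy of `a` is removed.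
  have hac : c ≠ a := by
    rintro rfl
    obtain ⟨j, hj⟩ := hT0
    exact mem_diffSet.1 (hTd hj) rfl
  obtain ⟨x', rfl⟩ := exists_eq_single_add ha
  have hc' : 0 < x' c := by simpa [hac] using hc
  obtain ⟨w, rfl⟩ := exists_eq_single_add hc'
  refine ⟨a', Pi.single a 1 + Pi.single c 1, Pi.single a' 1 + Pi.single c' 1, w, ha',
    (add_assoc _ _ _).symm, sum_pair _ _, pair_mem_fiber_pair.2 fun j => ?_, by simp⟩
  rw [ha', ‹D c' = _›]
  by_cases hj : j ∈ T
  · have := Int.units_ne_iff_eq_neg.1 (mem_diffSet.1 (hTd hj))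
    simp [flipOn, hj, this]
  · simp [flipOn, hj]

theorem card_diffSet_flipOn_lt {J : Type*} [Fintype J] [DecidableEq J] {u v : J → ℤˣ}
    {T : Finset J} (hT : T ⊆ diffSet u v) (hT0 : T.Nonempty) :
    (diffSet (flipOn T u) v).card < (diffSet u v).card := by
  refine Finset.card_lt_card ((Finset.ssubset_iff_of_subset fun j hj => ?_).2 ?_)
  · by_cases hjT : j ∈ T
    · exact hT hjT
    · rw [mem_diffSet] at hj ⊢
      simpa [flipOn, hjT] using hj
  · obtain ⟨j, hj⟩ := hT0
    refine ⟨j, hT hj, ?_⟩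
    have := Int.units_ne_iff_eq_neg.1 (mem_diffSet.1 (hT hj))
    simp [mem_diffSet, flipOn, hj, this]

/-- Two frequency vectors in the same fiber are related by every translation invariant
equivalence relation that relates the elements of the fibers of degree two. -/
theorem related_of_mem_fiber (hD : Function.Injective D)
    (hR : ∀ u, (∃ i, D i = u) ↔ ∏ j, u j = e) {r : (Fin k → ℕ) → (Fin k → ℕ) → Prop}
    (hr : Equivalence r) (hadd : ∀ u v w, r u v → r (u + w) (v + w))
    (h₂ : ∀ u v, ∑ i, u i = 2 → u ∈ fiber (modelMatrix D)ᵀ v → r u v) :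
    ∀ (n : ℕ) (x y : Fin k → ℕ), ∑ i, x i = n → x ∈ fiber (modelMatrix D)ᵀ y → r x y := by
  intro n
  induction n with
  | zero =>
    intro x y hx hxy
    have hy := sum_eq_of_mem_fiber hxy
    rw [hx] at hy
    have : x = y := funext fun i => by
      rw [Finset.sum_eq_zero_iff.1 hx i (Finset.mem_univ i),
        Finset.sum_eq_zero_iff.1 hy.symm i (Finset.mem_univ i)]
    exact this ▸ hr.refl x
  | succ n ih =>
    -- Inner induction on the Hamming distance between a run of `x` and a run of `y`; the outer one
    -- is on the degree.
    suffices H : ∀ (d : ℕ) (x y : Fin k → ℕ) (a b : Fin k), ∑ i, x i = n + 1 →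
        x ∈ fiber (modelMatrix D)ᵀ y → 0 < x a → 0 < y b →
        (diffSet (D a) (D b)).card = d → r x y by
      intro x y hx hxy
      obtain ⟨a, ha⟩ := exists_pos_of_sum_pos (x := x) (by lia)
      obtain ⟨b, hb⟩ := exists_pos_of_sum_pos (x := y) (by
        rw [← sum_eq_of_mem_fiber hxy]; lia)
      exact H _ x y a b hx hxy ha hb rfl
    intro d
    induction d using Nat.strong_induction_on with
    | _ d ihd =>
    -- the reduction step, used on either side
    have step : ∀ (x y : Fin k → ℕ) (a b c : Fin k), ∑ i, x i = n + 1 →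
        x ∈ fiber (modelMatrix D)ᵀ y → 0 < x a → 0 < y b →
        (diffSet (D a) (D b)).card = d → 2 ≤ d → 0 < x c →
        ∑ j ∈ diffSet (D a) (D b), (D c j : ℤ) * D a j < 0 → r x y := by
      intro x y a b c hx hxy ha hb hd hd2 hc hneg
      obtain ⟨T, hTS, hT2, hTd⟩ := exists_pair_ne_of_sum_neg (hd ▸ hd2) hneg
      have hT0 : T.Nonempty := Finset.card_pos.1 (by lia)
      obtain ⟨a', u, v, w, ha', rfl, hu, huv, hva'⟩ :=
        exists_flip_pair hR ha hc (by rw [hT2]; exact even_two) hT0 hTd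
      have hxv : u + w ∈ fiber (modelMatrix D)ᵀ (v + w) := (add_mem_fiber_add w).2 huv
      refine hr.trans (hadd u v w (h₂ u v hu huv)) (ihd (diffSet (D a') (D b)).card ?_ (v + w) y
        a' b ?_ ?_ ?_ hb rfl)
      · rw [← hd, ha']
        exact card_diffSet_flipOn_lt hTS hT0
      · rw [← sum_eq_of_mem_fiber hxv, hx]
      · rw [← fiber_eq_of_mem hxy]
        exact mem_fiber_comm.1 hxv
      · simp only [Pi.add_apply]; lia
    intro x y a b hx hxy ha hb hd
    have heven : Even d := hd ▸ even_card_diffSet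
      (((hR _).1 ⟨a, rfl⟩).trans ((hR _).1 ⟨b, rfl⟩).symm)
    -- At distance zero the two runs coincide; cancelling the common run lowers the degree.
    rcases Nat.eq_zero_or_pos d with hd0 | hdpos
    · have hab : a = b := by
        refine hD (funext fun j => ?_)
        by_contra hj
        have := Finset.card_eq_zero.1 (hd.trans hd0)
        exact absurd (this ▸ mem_diffSet.2 hj) (Finset.notMem_empty j)
      subst hab
      obtain ⟨x', rfl⟩ := exists_eq_single_add ha
      obtain ⟨y', rfl⟩ := exists_eq_single_add hb
      rw [add_comm _ x', add_comm _ y', add_mem_fiber_add] at hxy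
      rw [sum_single_add] at hx
      rw [add_comm _ x', add_comm _ y']
      exact hadd _ _ _ (ih x' y' (by lia) hxy)
    have hd2 : 2 ≤ d := by
      obtain ⟨m, rfl⟩ := heven
      lia
    let f : Fin k → ℤ := fun c => ∑ j ∈ diffSet (D a) (D b), (D c j : ℤ) * D a j
    -- Since `D b = -D a` on the disagreement set, exchanging the roles of `x` and `y` negates `f`;
    -- a positive value of `f` on the support of `y` thus permits the reduction step from that side.
    have hfb : ∀ c, ∑ j ∈ diffSet (D b) (D a), (D c j : ℤ) * D b j = -f c := by
      intro c
      rw [diffSet_comm, ← Finset.sum_neg_distrib]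
      refine Finset.sum_congr rfl fun j hj => ?_
      rw [Int.units_ne_iff_eq_neg.1 (mem_diffSet.1 hj)]
      simp
    -- `f` is a linear combination of the columns of `D`, whose weighted sums agree on a fiber.
    have hsum : ∑ c, (x c : ℤ) * f c = ∑ c, (y c : ℤ) * f c := by
      have h := (mem_fiber_modelMatrix.1 hxy).2
      simp only [f, Finset.mul_sum]
      rw [Finset.sum_comm, @Finset.sum_comm _ _ _ _ Finset.univ]
      refine Finset.sum_congr rfl fun j _ => ?_
      simp only [← mul_assoc, ← Finset.sum_mul, h j]
    by_cases hxneg : ∃ c, 0 < x c ∧ f c < 0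
    · obtain ⟨c, hc, hfc⟩ := hxneg
      exact step x y a b c hx hxy ha hb hd hd2 hc hfc
    by_cases hypos : ∃ c, 0 < y c ∧ 0 < f c
    · obtain ⟨c, hc, hfc⟩ := hypos
      refine hr.symm (step y x b a c ?_ (mem_fiber_comm.1 hxy) hb ha ?_ hd2 hc ?_)
      · rw [← sum_eq_of_mem_fiber hxy, hx]
      · rw [diffSet_comm, hd]
      · rw [hfb]; lia
    push Not at hxneg hypos
    -- Now `f` is nonnegative on the support of `x` and nonpositive on that of `y`, while `f a = d >
    -- 0`; this contradicts the equality of totals.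
    exfalso
    have hfa : 0 < f a := by
      have := sum_diffSet_mul_self (D a) (D b)
      simp only [f, this, hd]
      lia
    have hpos : 0 < ∑ c, (x c : ℤ) * f c := by
      refine Finset.sum_pos' (fun c _ => ?_) ⟨a, Finset.mem_univ a, by positivity⟩
      rcases Nat.eq_zero_or_pos (x c) with h | h
      · simp [h]
      · exact mul_nonneg (by positivity) (hxneg c h)
    have hnonpos : ∑ c, (y c : ℤ) * f c ≤ 0 := by
      refine Finset.sum_nonpos fun c _ => ?_
      rcases Nat.eq_zero_or_pos (y c) with h | h
      · simp [h]
      · exact mul_nonpos_of_nonneg_of_nonpos (by positivity) (hypos c h)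
    lia

/-- Markov bases of the design are detected on the essential fibers. -/
theorem isMarkovBasis_of_connected (hD : Function.Injective D)
    (hR : ∀ u, (∃ i, D i = u) ↔ ∏ j, u j = e) {B : Finset (Fin k → ℤ)}
    (hB : ∀ z ∈ B, IsMove (modelMatrix D)ᵀ z)
    (h : ∀ F, IsEssentialFiber (modelMatrix D)ᵀ F → (moveGraph F B).Connected) :
    IsMarkovBasis (modelMatrix D)ᵀ B := by
  refine ⟨hB, fun w => (moveGraph_fiber_connected_iff hB).2 fun x hx y hy => ?_⟩
  refine related_of_mem_fiber hD hR (Relation.EqvGen.is_equivalence _)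
    (fun u v w h => eqvGen_moveStep_add w h) (fun u v hu huv => ?_) _ x y rfl
    (by rwa [fiber_eq_of_mem hy])
  by_cases huv' : u = v
  · exact huv' ▸ .refl _
  · refine (moveGraph_fiber_connected_iff hB).1 (h (fiber _ v) ⟨⟨v, ?_, rfl⟩, ?_⟩) u huv v
      (self_mem_fiber v)
    · rw [← sum_eq_of_mem_fiber huv, hu]
    · exact ⟨u, huv, v, self_mem_fiber v, huv'⟩

end Design

/-! ### Sizes and numbers of the essential fibers. -/

section Counting

variable {k p : ℕ} {D : Fin k → Fin p → ℤˣ} {e : ℤˣ}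

theorem Int.units_cast_add_eq_iff (u v w t : ℤˣ) :
    (u : ℤ) + v = w + t ↔ if w = t then u = w ∧ v = w else v = -u := by
  revert u v w t
  decide

/-- Where `a` and `b` agree, the column sum is $\pm2$ and forces both `c` and `d`; where they
differ, it is $0$ and only says that `d` is opposite to `c`. -/
theorem pair_mem_fiber_pair_iff_flipOn {a b c d : Fin k} :
    (Pi.single c 1 + Pi.single d 1 : Fin k → ℕ) ∈
      fiber (modelMatrix D)ᵀ (Pi.single a 1 + Pi.single b 1) ↔
      (∀ j ∉ diffSet (D a) (D b), D c j = D a j) ∧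
        D d = flipOn (diffSet (D a) (D b)) (D c) := by
  rw [pair_mem_fiber_pair, funext_iff, ← forall_and]
  refine forall_congr' fun j => ?_
  rw [Int.units_cast_add_eq_iff, mem_diffSet, flipOn]
  by_cases h : D a j = D b j
  · simp only [h, if_true, mem_diffSet, ne_eq, not_true_eq_false, not_false_eq_true,
      forall_const, if_false]
    exact and_congr_right fun h' => by rw [h']
  · simp [h, mem_diffSet]

/-- On $S$ the run `c` is free up to its product, giving $2^{|S|-1}$ choices, and `c` determines
`d`. Every unordered pair is counted twice. -/
theorem ncard_fiber_pair (hD : Function.Injective D)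
    (hR : ∀ u, (∃ i, D i = u) ↔ ∏ j, u j = e) {a b : Fin k}
    (hS : 2 ≤ (diffSet (D a) (D b)).card) :
    (fiber (modelMatrix D)ᵀ (Pi.single a 1 + Pi.single b 1)).ncard =
      2 ^ ((diffSet (D a) (D b)).card - 2) := by
  classical
  have heven : Even (diffSet (D a) (D b)).card := even_card_diffSet
    (((hR _).1 ⟨a, rfl⟩).trans ((hR _).1 ⟨b, rfl⟩).symm)
  set S := diffSet (D a) (D b) with hSdef
  have hbar : ∀ c, ∃ c', D c' = flipOn S (D c) := fun c =>
    (hR _).2 (by rw [prod_flipOn_of_even heven]; exact (hR _).1 ⟨c, rfl⟩)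
  choose bar hbar using hbar
  -- Of the two runs in a pair exactly one agrees with `a` at `j₀`; choosing that one removes the
  -- double counting, and `R` collects these representatives.
  obtain ⟨j₀, hj₀⟩ : S.Nonempty := Finset.card_pos.1 (by lia)
  have hUcard : (S.erase j₀).card = S.card - 1 := Finset.card_erase_of_mem hj₀
  have hU : (S.erase j₀).Nonempty := Finset.card_pos.1 (by lia)
  let R : Finset (Fin k) := Finset.univ.filter fun c => ∀ j ∉ S.erase j₀, D c j = D a j
  have hRmem : ∀ c, c ∈ R ↔ D c j₀ = D a j₀ ∧ ∀ j ∉ S, D c j = D a j := by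
    intro c
    simp only [R, Finset.mem_filter, Finset.mem_univ, true_and, Finset.mem_erase, not_and]
    constructor
    · exact fun h => ⟨h j₀ fun h => absurd rfl h, fun j hj => h j fun _ => hj⟩
    · intro h j hj
      by_cases hjj : j = j₀
      · rw [hjj, h.1]
      · exact h.2 j (hj hjj)
  have hRcard : R.card = 2 ^ (S.card - 2) := by
    rw [show S.card - 2 = (S.erase j₀).card - 1 by lia,
      ← card_signs_off_prod_eq hU (D a) e]
    refine Finset.card_bij (fun c _ => D c) ?_ (fun _ _ _ _ h => hD h) ?_
    · intro c hc
      exact Finset.mem_filter.2 ⟨Finset.mem_univ _, (Finset.mem_filter.1 hc).2,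
        (hR _).1 ⟨c, rfl⟩⟩
    · intro u hu
      obtain ⟨-, h₁, h₂⟩ := Finset.mem_filter.1 hu
      obtain ⟨c, rfl⟩ := (hR u).2 h₂
      exact ⟨c, Finset.mem_filter.2 ⟨Finset.mem_univ _, h₁⟩, rfl⟩
  have himage : fiber (modelMatrix D)ᵀ (Pi.single a 1 + Pi.single b 1) =
      (fun c => (Pi.single c 1 + Pi.single (bar c) 1 : Fin k → ℕ)) '' R := by
    ext x
    constructor
    · intro hx
      obtain ⟨c, d, rfl⟩ := exists_eq_pair_of_sum_eq_two
        ((sum_eq_of_mem_fiber hx).trans (sum_pair a b))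
      obtain ⟨hc, hd⟩ := pair_mem_fiber_pair_iff_flipOn.1 hx
      obtain ⟨hd', hc'⟩ := pair_mem_fiber_pair_iff_flipOn.1
        (add_comm (Pi.single c 1 : Fin k → ℕ) (Pi.single d 1) ▸ hx)
      by_cases h : D c j₀ = D a j₀
      · refine ⟨c, (hRmem c).2 ⟨h, hc⟩, ?_⟩
        beta_reduce
        rw [hD ((hbar c).trans hd.symm)]
      · refine ⟨d, (hRmem d).2 ⟨?_, hd'⟩, ?_⟩
        · rw [hd, flipOn, if_pos hj₀, Int.units_ne_iff_eq_neg.1 h, neg_neg]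
        · beta_reduce
          rw [hD ((hbar d).trans hc'.symm), add_comm]
    · rintro ⟨c, hc, rfl⟩
      exact pair_mem_fiber_pair_iff_flipOn.2 ⟨((hRmem c).1 hc).2, hbar c⟩
  rw [himage, Set.InjOn.ncard_image, Set.ncard_coe_finset, hRcard]
  intro c hc d hd hcd
  have h : (Pi.single d 1 + Pi.single (bar d) 1 : Fin k → ℕ) c ≠ 0 := by
    rw [← show (Pi.single c 1 + Pi.single (bar c) 1 : Fin k → ℕ) =
      Pi.single d 1 + Pi.single (bar d) 1 from hcd]
    simp
  by_contra hne
  have hcb : c = bar d := by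
    by_contra hcb
    simp [hne, hcb] at h
  have h₁ := ((hRmem c).1 hc).1
  rw [hcb, hbar, flipOn, if_pos hj₀, ((hRmem d).1 hd).1] at h₁
  exact Int.units_ne_iff_eq_neg.2 h₁.symm rfl

/-- Essential fibers are the fibers of pairs of runs that differ on at least four factors. -/
theorem isEssentialFiber_iff (hD : Function.Injective D)
    (hR : ∀ u, (∃ i, D i = u) ↔ ∏ j, u j = e) {F : Set (Fin k → ℕ)} :
    IsEssentialFiber (modelMatrix D)ᵀ F ↔ ∃ (a b : Fin k) (n : ℕ), 1 ≤ n ∧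
      (diffSet (D a) (D b)).card = 2 * (n + 1) ∧
      F = fiber (modelMatrix D)ᵀ (Pi.single a 1 + Pi.single b 1) ∧ F.ncard = 4 ^ n := by
  have hncard : ∀ (a b : Fin k) (n : ℕ), (diffSet (D a) (D b)).card = 2 * (n + 1) →
      (fiber (modelMatrix D)ᵀ (Pi.single a 1 + Pi.single b 1)).ncard = 4 ^ n := by
    intro a b n hn
    rw [ncard_fiber_pair hD hR (by lia), hn, show 2 * (n + 1) - 2 = 2 * n by lia, pow_mul]
    norm_num
  constructor
  · rintro ⟨⟨y, hy, rfl⟩, hnt⟩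
    obtain ⟨a, b, rfl⟩ := exists_eq_pair_of_sum_eq_two hy
    have heven : Even (diffSet (D a) (D b)).card := even_card_diffSet
      (((hR _).1 ⟨a, rfl⟩).trans ((hR _).1 ⟨b, rfl⟩).symm)
    obtain ⟨m, hm⟩ := heven
    have hone := (Set.one_lt_ncard (finite_fiber _)).2 hnt
    -- Distance $0$ gives a one-element fiber, where `ncard_fiber_pair` does not apply. Distance
    -- $2$, the case `n = 0` below, has size $4^0=1$ and is excluded as well.
    rcases Nat.eq_zero_or_pos m with rfl | hmpos
    · exfalso
      have hab : ∀ j, D a j = D b j := fun j => by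
        by_contra hj
        exact absurd (Finset.card_eq_zero.1 hm ▸ mem_diffSet.2 hj) (Finset.notMem_empty j)
      obtain ⟨x, hx, y, hy, hxy⟩ := hnt
      have huniq : ∀ x ∈ fiber (modelMatrix D)ᵀ (Pi.single a 1 + Pi.single b 1),
          x = Pi.single a 1 + Pi.single a 1 := by
        intro x hx
        obtain ⟨c, d, rfl⟩ := exists_eq_pair_of_sum_eq_two
          ((sum_eq_of_mem_fiber hx).trans (sum_pair a b))
        rw [pair_mem_fiber_pair] at hx
        have hcd : ∀ j, D c j = D a j ∧ D d j = D a j := fun j => by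
          simpa [hab j, Int.units_cast_add_eq_iff] using hx j
        rw [hD (funext fun j => (hcd j).1), hD (funext fun j => (hcd j).2)]
      exact hxy ((huniq x hx).trans (huniq y hy).symm)
    · obtain ⟨n, rfl⟩ : ∃ n, m = n + 1 := ⟨m - 1, by lia⟩
      have hn := hncard a b n (by lia)
      refine ⟨a, b, n, ?_, by lia, rfl, hn⟩
      by_contra h0
      rw [show n = 0 by lia] at hn
      lia
  · rintro ⟨a, b, n, hn, hcard, rfl, h⟩
    refine ⟨⟨_, sum_pair a b, rfl⟩, (Set.one_lt_ncard (finite_fiber _)).1 ?_⟩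
    rw [h]
    exact Nat.one_lt_pow (by lia) (by norm_num)

/-- The frequency vectors of degree two with column sums `c`. -/
def degreeTwoFiber (D : Fin k → Fin p → ℤˣ) (c : Fin p → ℤ) : Set (Fin k → ℕ) :=
  {x | ∑ i, x i = 2 ∧ ∀ j, ∑ i, (x i : ℤ) * D i j = c j}

theorem fiber_pair_eq_degreeTwoFiber (a b : Fin k) :
    fiber (modelMatrix D)ᵀ (Pi.single a 1 + Pi.single b 1) =
      degreeTwoFiber D fun j => (D a j : ℤ) + D b j := by
  ext x
  rw [mem_fiber_modelMatrix, sum_pair]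
  simp only [sum_pair_mul]
  rfl

/-- The column sums of pairs of sign vectors that differ on exactly `r` factors. -/
def pairSums (p r : ℕ) : Finset (Fin p → ℤ) :=
  (Fintype.piFinset fun _ => {-2, 0, 2}).filter fun c =>
    (Finset.univ.filter fun j => c j = 0).card = r

theorem card_pairSums (p r : ℕ) : (pairSums p r).card = p.choose r * 2 ^ (p - r) := by
  rw [Finset.card_eq_sum_card_fiberwise (f := fun c => Finset.univ.filter fun j => c j = 0)
    (t := Finset.powersetCard r Finset.univ)]
  · rw [Finset.sum_const_nat (m := 2 ^ (p - r)), Finset.card_powersetCard, Finset.card_fin]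
    intro S hS
    have hScard := (Finset.mem_powersetCard.1 hS).2
    have : (pairSums p r).filter (fun c => (Finset.univ.filter fun j => c j = 0) = S) =
        Fintype.piFinset fun j => if j ∈ S then {0} else {-2, 2} := by
      ext c
      simp only [pairSums, Finset.mem_filter, Fintype.mem_piFinset]
      constructor
      · rintro ⟨⟨h₁, -⟩, rfl⟩ j
        have := h₁ j
        by_cases hj : c j = 0
        · simp [hj]
        · simpa [hj] using this
      · intro h
        have hS' : (Finset.univ.filter fun j => c j = 0) = S := by
          ext j
          have := h j
          by_cases hj : j ∈ S
          · simpa [hj] using this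
          · simp only [hj, if_false, Finset.mem_insert, Finset.mem_singleton] at this
            simp only [Finset.mem_filter, Finset.mem_univ, true_and, hj, iff_false]
            lia
        refine ⟨⟨fun j => ?_, by rw [hS', hScard]⟩, hS'⟩
        have := h j
        by_cases hj : j ∈ S
        · simp only [hj, if_true, Finset.mem_singleton] at this
          simp [this]
        · simp only [hj, if_false, Finset.mem_insert, Finset.mem_singleton] at this
          rcases this with h | h <;> simp [h]
    rw [this, Fintype.card_piFinset]
    simp [apply_ite Finset.card, Finset.prod_ite, Finset.filter_not, Finset.card_sdiff, hScard]
  · intro c hc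
    exact Finset.mem_coe.2 (Finset.mem_powersetCard.2
      ⟨Finset.subset_univ _, (Finset.mem_filter.1 (Finset.mem_coe.1 hc)).2⟩)

theorem Int.units_add_mem (u v : ℤˣ) :
    (u : ℤ) + v ∈ ({-2, 0, 2} : Finset ℤ) ∧ ((u : ℤ) + v = 0 ↔ u ≠ v) := by
  revert u v
  decide

theorem add_mem_pairSums (u v : Fin p → ℤˣ) :
    (fun j => (u j : ℤ) + v j) ∈ pairSums p (diffSet u v).card := by
  refine Finset.mem_filter.2 ⟨Fintype.mem_piFinset.2 fun j => (Int.units_add_mem _ _).1, ?_⟩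
  simp only [Int.units_add_mem]
  rfl

theorem exists_runs_of_mem_pairSums (hR : ∀ u, (∃ i, D i = u) ↔ ∏ j, u j = e) {n : ℕ}
    {c : Fin p → ℤ} (hc : c ∈ pairSums p (2 * (n + 1))) :
    ∃ a b : Fin k, (diffSet (D a) (D b)).card = 2 * (n + 1) ∧
      c = fun j => (D a j : ℤ) + D b j := by
  obtain ⟨hc, hcard⟩ := Finset.mem_filter.1 hc
  set S := Finset.univ.filter fun j => c j = 0 with hS
  -- The nonzero entries of `c` fix the signs off `S`; the nonempty zero set `S` leaves room to
  -- achieve the product `e`. The reference values on `S` are immaterial.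
  have hpos := card_signs_off_prod_eq (U := S) (Finset.card_pos.1 (by lia))
    (fun j => if c j = 2 then 1 else -1) e
  obtain ⟨u, hu⟩ := Finset.card_pos.1 (hpos ▸ Nat.two_pow_pos _)
  obtain ⟨-, hu, hue⟩ := Finset.mem_filter.1 hu
  obtain ⟨a, rfl⟩ := (hR u).2 hue
  obtain ⟨b, hb⟩ := (hR (flipOn S (D a))).2
    (by rw [prod_flipOn_of_even (by rw [hcard]; exact even_two_mul _), hue])
  refine ⟨a, b, by rw [hb, diffSet_flipOn, hcard], funext fun j => ?_⟩
  rw [hb, flipOn]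
  by_cases hj : j ∈ S
  · simp [hj, (Finset.mem_filter.1 hj).2]
  · have h := Fintype.mem_piFinset.1 hc j
    simp only [Finset.mem_insert, Finset.mem_singleton] at h
    rw [if_neg hj, hu j hj]
    simp only [hS, Finset.mem_filter, Finset.mem_univ, true_and] at hj
    rcases h with h | h | h
    · simp [h]
    · exact absurd h hj
    · simp [h]

/-- An essential fiber is determined by its column sums, and those with $2(n+1)$ zeros are exactly
the ones giving size $4^n$. So the count is over zero sets and signs of the remaining entries. -/
theorem ncard_essentialFibers (hD : Function.Injective D)
    (hR : ∀ u, (∃ i, D i = u) ↔ ∏ j, u j = e) {n : ℕ} (hn : 1 ≤ n) :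
    (essentialFibers (modelMatrix D)ᵀ (4 ^ n)).ncard =
      p.choose (2 * (n + 1)) * 2 ^ (p - 2 * (n + 1)) := by
  have himage : essentialFibers (modelMatrix D)ᵀ (4 ^ n) =
      degreeTwoFiber D '' (pairSums p (2 * (n + 1)) : Set (Fin p → ℤ)) := by
    ext F
    constructor
    · rintro ⟨hF, hcard⟩
      obtain ⟨a, b, m, -, hm, rfl, hcard'⟩ := (isEssentialFiber_iff hD hR).1 hF
      rw [hcard] at hcard'
      rw [← Nat.pow_right_injective (le_refl 4 |>.trans' (by norm_num)) hcard'] at hm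
      rw [fiber_pair_eq_degreeTwoFiber]
      exact ⟨_, Finset.mem_coe.2 (hm ▸ add_mem_pairSums (D a) (D b)), rfl⟩
    · rintro ⟨c, hc, rfl⟩
      obtain ⟨a, b, hab, rfl⟩ := exists_runs_of_mem_pairSums hR (Finset.mem_coe.1 hc)
      rw [← fiber_pair_eq_degreeTwoFiber]
      have hcard : (fiber (modelMatrix D)ᵀ (Pi.single a 1 + Pi.single b 1)).ncard = 4 ^ n := by
        rw [ncard_fiber_pair hD hR (by lia), hab, show 2 * (n + 1) - 2 = 2 * n by lia, pow_mul]
        norm_num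
      exact ⟨(isEssentialFiber_iff hD hR).2 ⟨a, b, n, hn, hab, rfl, hcard⟩, hcard⟩
  rw [himage, Set.InjOn.ncard_image, Set.ncard_coe_finset, card_pairSums]
  intro c hc c' _ h
  obtain ⟨a, b, -, rfl⟩ := exists_runs_of_mem_pairSums hR (Finset.mem_coe.1 hc)
  have hmem : (Pi.single a 1 + Pi.single b 1 : Fin k → ℕ) ∈ degreeTwoFiber D c' := by
    rw [← show degreeTwoFiber D _ = degreeTwoFiber D c' from h, ← fiber_pair_eq_degreeTwoFiber]
    exact self_mem_fiber _
  funext j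
  rw [← hmem.2 j, sum_pair_mul]

theorem ncard_of_isEssentialFiber (hD : Function.Injective D)
    (hR : ∀ u, (∃ i, D i = u) ↔ ∏ j, u j = e) {s : ℕ} (hs : p ≤ 2 * s + 1)
    {F : Set (Fin k → ℕ)} (hF : IsEssentialFiber (modelMatrix D)ᵀ F) :
    ∃ t ∈ Finset.Icc 1 (s - 1), F.ncard = 4 ^ (s - t) := by
  obtain ⟨a, b, n, hn, hab, -, hcard⟩ := (isEssentialFiber_iff hD hR).1 hF
  have := (diffSet (D a) (D b)).card_le_univ
  rw [Fintype.card_fin] at this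
  -- From $2(n+1)\le p\le 2s+1$ follows $n\le s-1$, so $t=s-n\ge1$.
  exact ⟨s - n, Finset.mem_Icc.2 ⟨by lia, by lia⟩, by rw [hcard]; congr 1; lia⟩

theorem card_of_minimal_connectsFiber_of_isEssentialFiber (hD : Function.Injective D)
    {F : Set (Fin k → ℕ)} (hF : IsEssentialFiber (modelMatrix D)ᵀ F) {C : Finset (Fin k → ℤ)}
    (hC : Minimal (ConnectsFiber F) C) : C.card = F.ncard - 1 := by
  obtain ⟨⟨w, hw, rfl⟩, -⟩ := hF
  have := card_of_minimal_connectsFiber (finite_fiber w) (fun x hx y hy x' hx' y' hy' =>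
    pair_unique_of_difference hD ((sum_eq_of_mem_fiber hx).trans hw)
      ((sum_eq_of_mem_fiber hx').trans hw) (by rwa [fiber_eq_of_mem hy])
      (by rwa [fiber_eq_of_mem hy'])) hC
  lia

theorem exists_minimal_isMarkovBasis (hD : Function.Injective D)
    (hR : ∀ u, (∃ i, D i = u) ↔ ∏ j, u j = e) :
    ∃ B, Minimal (IsMarkovBasis (modelMatrix D)ᵀ) B := by
  classical
  have : ∀ F, ∃ C, IsEssentialFiber (modelMatrix D)ᵀ F → Minimal (ConnectsFiber F) C := by
    intro F
    by_cases hF : IsEssentialFiber (modelMatrix D)ᵀ F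
    · obtain ⟨C, hC⟩ : ∃ C, Minimal (ConnectsFiber F) C := by
        refine exists_minimal_connectsFiber ?_ hF.2.nonempty
        obtain ⟨⟨w, -, rfl⟩, -⟩ := hF
        exact finite_fiber w
      exact ⟨C, fun _ => hC⟩
    · exact ⟨∅, fun h => absurd h hF⟩
  choose C hC using this
  refine ⟨(finite_isEssentialFiber (D := D)).toFinset.biUnion C, (minimal_isMarkovBasis_iff
    (fun _ => isMarkovBasis_of_connected hD hR)
    (fun _ _ hF hF' _ => hF.eq_of_isFiberMove hD hF') _).2 ⟨C, hC, ?_⟩⟩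
  rw [Finset.coe_biUnion]
  simp

theorem card_of_minimal_isMarkovBasis (hD : Function.Injective D)
    (hR : ∀ u, (∃ i, D i = u) ↔ ∏ j, u j = e) {s : ℕ} (hs : p ≤ 2 * s + 1)
    {B : Finset (Fin k → ℤ)} (hB : Minimal (IsMarkovBasis (modelMatrix D)ᵀ) B) :
    B.card = ∑ t ∈ Finset.Icc 1 (s - 1),
      (essentialFibers (modelMatrix D)ᵀ (4 ^ (s - t))).ncard * (4 ^ (s - t) - 1) := by
  classical
  have hU : ∀ F F', IsEssentialFiber (modelMatrix D)ᵀ F → IsEssentialFiber (modelMatrix D)ᵀ F' →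
      ∀ z, IsFiberMove F z → IsFiberMove F' z → F = F' :=
    fun _ _ hF hF' _ => hF.eq_of_isFiberMove hD hF'
  obtain ⟨C, hC, hBC⟩ := (minimal_isMarkovBasis_iff
    (fun _ => isMarkovBasis_of_connected hD hR) hU B).1 hB
  rw [card_eq_sum_of_eq_iUnion hU finite_isEssentialFiber hC hBC,
    Finset.sum_congr rfl fun F hF => card_of_minimal_connectsFiber_of_isEssentialFiber hD
      (finite_isEssentialFiber.mem_toFinset.1 hF) (hC F (finite_isEssentialFiber.mem_toFinset.1 hF))]
  have hinj : Set.InjOn (fun t => 4 ^ (s - t)) (Finset.Icc 1 (s - 1) : Set ℕ) := by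
    intro t ht t' ht' h
    have := Nat.pow_right_injective (by norm_num : 2 ≤ 4) h
    rw [Finset.mem_coe, Finset.mem_Icc] at ht ht'
    lia
  -- The sum over `t` is reindexed by the fiber size $m=4^{s-t}$, which allows the essential fibers
  -- to be grouped by size.
  rw [← Finset.sum_image (g := fun t => 4 ^ (s - t))
    (f := fun m => (essentialFibers (modelMatrix D)ᵀ m).ncard * (m - 1)) hinj,
    ← Finset.sum_fiberwise_of_maps_to (g := Set.ncard) (t := (Finset.Icc 1 (s - 1)).image
      fun t => 4 ^ (s - t))]
  · refine Finset.sum_congr rfl fun m _ => ?_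
    have : essentialFibers (modelMatrix D)ᵀ m =
        (finite_isEssentialFiber (D := D)).toFinset.filter fun F => F.ncard = m := by
      ext F
      simp [essentialFibers]
    rw [this, Set.ncard_coe_finset]
    exact Finset.sum_const_nat fun F hF => by rw [(Finset.mem_filter.1 hF).2]
  · intro F hF
    obtain ⟨t, ht, h⟩ := ncard_of_isEssentialFiber hD hR hs
      (finite_isEssentialFiber.mem_toFinset.1 hF)
    exact Finset.mem_image.2 ⟨t, ht, h.symm⟩

/-- A design of maximal resolution consists of all runs satisfying one relation of full length. -/
theorem exists_prod_eq_iff_of_hasResolution {D : Fin (2 ^ (p - 1)) → Fin p → ℤˣ}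
    (hD : Function.Injective D) (hres : HasResolution D p) :
    ∃ e : ℤˣ, ∀ u, (∃ i, D i = u) ↔ ∏ j, u j = e := by
  classical
  obtain ⟨⟨w, ⟨hne, e, he⟩, hw⟩, -⟩ := hres
  have hwu : w = Finset.univ := by
    rw [← Finset.card_eq_iff_eq_univ, hw, Fintype.card_fin]
  subst hwu
  refine ⟨e, fun u => ?_⟩
  -- Every run satisfies the full-length relation, and both sets have $2^{p-1}$ elements.
  have heq : Finset.univ.image D = Finset.univ.filter fun u => ∏ j, u j = e := by
    refine Finset.eq_of_subset_of_card_le (fun u hu => ?_) ?_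
    · obtain ⟨i, -, rfl⟩ := Finset.mem_image.1 hu
      exact Finset.mem_filter.2 ⟨Finset.mem_univ _, he i⟩
    · have := card_signs_off_prod_eq hne (1 : Fin p → ℤˣ) e
      simp only [Finset.mem_univ, not_true_eq_false, false_imp_iff, implies_true,
        true_and] at this
      rw [this, hw, Finset.card_image_of_injective _ hD, Finset.card_univ, Fintype.card_fin]
  have := Finset.ext_iff.1 heq u
  simpa using this

end Counting

end FactorialDesign

/-! ### The main theorem: explicit counts for both parities of $p$. -/

theorem mainTheorem3 (p : ℕ) (D : Fin (2 ^ (p - 1)) → Fin p → ℤˣ)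
    (hreg : FactorialDesign.IsRegularFraction D)
    (hres : FactorialDesign.HasResolution D p) :
    -- the minimal Markov bases, for `p = 2s` and for `p = 2s + 1`
    (∀ s : ℕ, p = 2 * s ∨ p = 2 * s + 1 →
      (∀ F, FactorialDesign.IsEssentialFiber (FactorialDesign.modelMatrix D)ᵀ F ↔
        ∃ t ∈ Finset.Icc 1 (s - 1),
          F ∈ FactorialDesign.essentialFibers (FactorialDesign.modelMatrix D)ᵀ (4 ^ (s - t))) ∧
      (∃ B, Minimal (FactorialDesign.IsMarkovBasis (FactorialDesign.modelMatrix D)ᵀ) B) ∧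
      (∀ B : Finset (Fin (2 ^ (p - 1)) → ℤ),
        Minimal (FactorialDesign.IsMarkovBasis (FactorialDesign.modelMatrix D)ᵀ) B ↔
        ∃ C : Set (Fin (2 ^ (p - 1)) → ℕ) → Finset (Fin (2 ^ (p - 1)) → ℤ),
          (∀ F, FactorialDesign.IsEssentialFiber (FactorialDesign.modelMatrix D)ᵀ F →
            Minimal (FactorialDesign.ConnectsFiber F) (C F)) ∧
          (B : Set (Fin (2 ^ (p - 1)) → ℤ)) =
            ⋃ t ∈ Finset.Icc 1 (s - 1),
              ⋃ F ∈ FactorialDesign.essentialFibers (FactorialDesign.modelMatrix D)ᵀ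
                (4 ^ (s - t)),
                (C F : Set (Fin (2 ^ (p - 1)) → ℤ))) ∧
      (∀ t ∈ Finset.Icc 1 (s - 1),
        ∀ F ∈ FactorialDesign.essentialFibers (FactorialDesign.modelMatrix D)ᵀ (4 ^ (s - t)),
        ∀ C, Minimal (FactorialDesign.ConnectsFiber F) C → C.card = 4 ^ (s - t) - 1)) ∧
    -- the number of essential fibers and the size of a minimal Markov basis, for `p = 2s`
    (∀ s : ℕ, p = 2 * s →
      (∀ t ∈ Finset.Icc 1 (s - 1),
        (FactorialDesign.essentialFibers (FactorialDesign.modelMatrix D)ᵀ (4 ^ (s - t))).ncard =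
          4 ^ (t - 1) * p.choose (2 * (t - 1))) ∧
      ∀ B, Minimal (FactorialDesign.IsMarkovBasis (FactorialDesign.modelMatrix D)ᵀ) B →
        B.card = ∑ t ∈ Finset.Icc 1 (s - 1),
          4 ^ (t - 1) * p.choose (2 * (t - 1)) * (4 ^ (s - t) - 1)) ∧
    -- the number of essential fibers and the size of a minimal Markov basis, for `p = 2s + 1`
    (∀ s : ℕ, p = 2 * s + 1 →
      (∀ t ∈ Finset.Icc 1 (s - 1),
        (FactorialDesign.essentialFibers (FactorialDesign.modelMatrix D)ᵀ (4 ^ (s - t))).ncard =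
          2 ^ (2 * t - 1) * p.choose (2 * t - 1)) ∧
      ∀ B, Minimal (FactorialDesign.IsMarkovBasis (FactorialDesign.modelMatrix D)ᵀ) B →
        B.card = ∑ t ∈ Finset.Icc 1 (s - 1),
          2 ^ (2 * t - 1) * p.choose (2 * t - 1) * (4 ^ (s - t) - 1)) ∧
    -- the sizes for `p = 4, …, 8`
    (∀ B, Minimal (FactorialDesign.IsMarkovBasis (FactorialDesign.modelMatrix D)ᵀ) B →
      (p = 4 → B.card = 3) ∧ (p = 5 → B.card = 30) ∧ (p = 6 → B.card = 195) ∧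
      (p = 7 → B.card = 1050) ∧ (p = 8 → B.card = 5103)) := by
  obtain ⟨e, hR⟩ := FactorialDesign.exists_prod_eq_iff_of_hasResolution hreg.1 hres
  have hD := hreg.1
  have hcount : ∀ s t : ℕ, t ∈ Finset.Icc 1 (s - 1) →
      (FactorialDesign.essentialFibers (FactorialDesign.modelMatrix D)ᵀ (4 ^ (s - t))).ncard =
        p.choose (2 * (s - t + 1)) * 2 ^ (p - 2 * (s - t + 1)) := fun s t ht =>
    FactorialDesign.ncard_essentialFibers hD hR (by rw [Finset.mem_Icc] at ht; lia)
  have heven : ∀ s : ℕ, p = 2 * s →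
      (∀ t ∈ Finset.Icc 1 (s - 1),
        (FactorialDesign.essentialFibers (FactorialDesign.modelMatrix D)ᵀ (4 ^ (s - t))).ncard =
          4 ^ (t - 1) * p.choose (2 * (t - 1))) ∧
      ∀ B, Minimal (FactorialDesign.IsMarkovBasis (FactorialDesign.modelMatrix D)ᵀ) B →
        B.card = ∑ t ∈ Finset.Icc 1 (s - 1),
          4 ^ (t - 1) * p.choose (2 * (t - 1)) * (4 ^ (s - t) - 1) := by
    intro s hs
    have h : ∀ t ∈ Finset.Icc 1 (s - 1),
        (FactorialDesign.essentialFibers (FactorialDesign.modelMatrix D)ᵀ (4 ^ (s - t))).ncard =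
          4 ^ (t - 1) * p.choose (2 * (t - 1)) := by
      intro t ht
      rw [hcount s t ht, mul_comm]
      rw [Finset.mem_Icc] at ht
      -- Symmetry of the binomial coefficient passes from the $2(s-t+1)$ factors where the runs
      -- differ to the $2(t-1)$ where they agree; for odd $p$ the latter number is $2t-1$.
      rw [show p - 2 * (s - t + 1) = 2 * (t - 1) by lia, pow_mul,
        Nat.choose_symm_of_eq_add (show p = 2 * (s - t + 1) + 2 * (t - 1) by lia)]
      norm_num
    refine ⟨h, fun B hB => ?_⟩
    rw [FactorialDesign.card_of_minimal_isMarkovBasis hD hR (s := s) (by lia) hB]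
    exact Finset.sum_congr rfl fun t ht => by rw [h t ht]
  have hodd : ∀ s : ℕ, p = 2 * s + 1 →
      (∀ t ∈ Finset.Icc 1 (s - 1),
        (FactorialDesign.essentialFibers (FactorialDesign.modelMatrix D)ᵀ (4 ^ (s - t))).ncard =
          2 ^ (2 * t - 1) * p.choose (2 * t - 1)) ∧
      ∀ B, Minimal (FactorialDesign.IsMarkovBasis (FactorialDesign.modelMatrix D)ᵀ) B →
        B.card = ∑ t ∈ Finset.Icc 1 (s - 1),
          2 ^ (2 * t - 1) * p.choose (2 * t - 1) * (4 ^ (s - t) - 1) := by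
    intro s hs
    have h : ∀ t ∈ Finset.Icc 1 (s - 1),
        (FactorialDesign.essentialFibers (FactorialDesign.modelMatrix D)ᵀ (4 ^ (s - t))).ncard =
          2 ^ (2 * t - 1) * p.choose (2 * t - 1) := by
      intro t ht
      rw [hcount s t ht, mul_comm]
      rw [Finset.mem_Icc] at ht
      rw [show p - 2 * (s - t + 1) = 2 * t - 1 by lia,
        Nat.choose_symm_of_eq_add (show p = 2 * (s - t + 1) + (2 * t - 1) by lia)]
    refine ⟨h, fun B hB => ?_⟩
    rw [FactorialDesign.card_of_minimal_isMarkovBasis hD hR (s := s) (by lia) hB]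
    exact Finset.sum_congr rfl fun t ht => by rw [h t ht]
  refine ⟨fun s hs => ?_, heven, hodd, fun B hB => ⟨fun h => ?_, fun h => ?_, fun h => ?_,
    fun h => ?_, fun h => ?_⟩⟩
  · have hess : ∀ F, FactorialDesign.IsEssentialFiber (FactorialDesign.modelMatrix D)ᵀ F ↔
        ∃ t ∈ Finset.Icc 1 (s - 1),
          F ∈ FactorialDesign.essentialFibers (FactorialDesign.modelMatrix D)ᵀ (4 ^ (s - t)) := by
      refine fun F => ⟨fun hF => ?_, fun ⟨_, _, hF⟩ => hF.1⟩
      obtain ⟨t, ht, h⟩ := FactorialDesign.ncard_of_isEssentialFiber hD hR (s := s) (by lia) hF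
      exact ⟨t, ht, hF, h⟩
    refine ⟨hess, FactorialDesign.exists_minimal_isMarkovBasis hD hR, fun B => ?_,
      fun t _ F hF C hC => ?_⟩
    · rw [FactorialDesign.minimal_isMarkovBasis_iff
        (fun _ => FactorialDesign.isMarkovBasis_of_connected hD hR)
        (fun _ _ hF hF' _ => hF.eq_of_isFiberMove hD hF')]
      refine exists_congr fun C => and_congr_right fun _ => ?_
      have : (⋃ F ∈ {F | FactorialDesign.IsEssentialFiber (FactorialDesign.modelMatrix D)ᵀ F},
          (C F : Set (Fin (2 ^ (p - 1)) → ℤ))) = ⋃ t ∈ Finset.Icc 1 (s - 1),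
          ⋃ F ∈ FactorialDesign.essentialFibers (FactorialDesign.modelMatrix D)ᵀ (4 ^ (s - t)),
            (C F : Set (Fin (2 ^ (p - 1)) → ℤ)) := by
        ext z
        simp only [Set.mem_iUnion, Set.mem_ofPred_eq, exists_prop, hess]
        exact ⟨fun ⟨F, ⟨t, ht, hF⟩, hz⟩ => ⟨t, ht, F, hF, hz⟩,
          fun ⟨t, ht, F, hF, hz⟩ => ⟨F, ⟨t, ht, hF⟩, hz⟩⟩
      rw [this]
    · rw [FactorialDesign.card_of_minimal_connectsFiber_of_isEssentialFiber hD hF.1 hC, hF.2]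
  · rw [(heven 2 h).2 B hB, h]; decide
  · rw [(hodd 2 h).2 B hB, h]; decide
  · rw [(heven 3 h).2 B hB, h]; decide
  · rw [(hodd 3 h).2 B hB, h]; decide
  · rw [(heven 4 h).2 B hB, h]; decide
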